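/- **Theorem.** Let $k\ge 0$. A *semidiversity* on $\mathbb{R}^k$ is a function $\delta\ge 0$ on the finite subsets of $\mathbb{R}^k$ such that $\delta(A)=0$ whenever $|A|\le 1$, and $\delta(A\cup C)\le\delta(A\cup B)+\delta(B\cup C)$ for all finite $A,B,C$ with $B\neq\emptyset$. It is *linear* if $\delta(\lambda A)=\lambda\,\delta(A)$ and $\delta(A+B)=\delta(A)+\delta(B)$ for all $\lambda\ge 0$ and all nonempty finite $A,B\subseteq\mathbb{R}^k$, where $A+B$ is the Minkowski sum. A linear semidiversity $\delta\neq 0$ is *extremal* if, whenever $\delta=t\delta_1+(1-t)\delta_2$ with $0<t<1$ and linear semidiversities $\delta_1,\delta_2$ on $\mathbb{R}^k$, both $\delta_1$ and $\delta_2$ are non-negative multiples of $\delta$. Let $\mathcal{E}_k$ be the set of extremal linear semidiversities on $\mathbb{R}^k$, with the $\sigma$-algebra generated by the evaluation maps $d\mapsto d(A)$, $A\subseteq\mathbb{R}^k$ finite. Let $\delta$ be a semidiversity on $\mathbb{R}^k$ that is not identically zero. Then $\delta$ is linear if and only if it is a convex combination (weighted average) of extremal linear semidiversities, i.e. there is a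 probability measure $\mu$ on $\mathcal{E}_k$ such that for every finite $A\subseteq\mathbb{R}^k$ the map $d\mapsto d(A)$ is $\mu$-integrable and $$\delta(A)=\int_{\mathcal{E}_k} d(A)\,\mathrm{d}\mu(d).$$ -/

import Mathlib

open scoped Pointwise
open MeasureTheory

open scoped Classical in
/-- A semidiversity on `X`: a non-negative function on the finite subsets of `X` which vanishes on
sets with at most one element and satisfies the triangle inequality for sets. -/
structure IsSemidiversity {X : Type*} (δ : Finset X → ℝ) : Prop where
  nonneg : ∀ A : Finset X, 0 ≤ δ A
  eq_zero_of_card_le_one : ∀ A : Finset X, A.card ≤ 1 → δ A = 0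
  triangle : ∀ A B C : Finset X, B.Nonempty → δ (A ∪ C) ≤ δ (A ∪ B) + δ (B ∪ C)

open scoped Classical in
/-- (Minkowski) linearity of a function on the finite subsets of `ℝ^k`; `c • A` and `A + B` are the
pointwise dilate and the Minkowski sum. -/
structure IsMinkowskiLinear {k : ℕ} (δ : Finset (EuclideanSpace ℝ (Fin k)) → ℝ) : Prop where
  map_smul : ∀ (c : ℝ) (A : Finset (EuclideanSpace ℝ (Fin k))), 0 ≤ c → A.Nonempty →
    δ (c • A) = c * δ A
  map_add : ∀ A B : Finset (EuclideanSpace ℝ (Fin k)), A.Nonempty → B.Nonempty →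
    δ (A + B) = δ A + δ B

/-- A linear semidiversity on `ℝ^k`. -/
structure IsLinearSemidiversity {k : ℕ} (δ : Finset (EuclideanSpace ℝ (Fin k)) → ℝ) : Prop where
  semidiversity : IsSemidiversity δ
  linear : IsMinkowskiLinear δ

/-- `δ'` is a scale copy of `δ`: a non-negative multiple of it. -/
def IsScaleCopy {X : Type*} (δ' δ : Finset X → ℝ) : Prop :=
  ∃ c : ℝ, 0 ≤ c ∧ δ' = c • δ

/-- An extremal linear semidiversity on `ℝ^k`: a non-zero linear semidiversity spanning an extremal
ray of the cone of linear semidiversities, i.e. whenever it is a proper convex combination of two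
linear semidiversities, these are scale copies of it. -/
structure IsExtremalLinearSemidiversity {k : ℕ}
    (δ : Finset (EuclideanSpace ℝ (Fin k)) → ℝ) : Prop where
  linearSemidiversity : IsLinearSemidiversity δ
  ne_zero : δ ≠ 0
  extremal : ∀ (δ₁ δ₂ : Finset (EuclideanSpace ℝ (Fin k)) → ℝ) (t : ℝ),
    IsLinearSemidiversity δ₁ → IsLinearSemidiversity δ₂ → 0 < t → t < 1 →
    δ = t • δ₁ + (1 - t) • δ₂ → IsScaleCopy δ₁ δ ∧ IsScaleCopy δ₂ δ

/-- The set of extremal linear semidiversities on `ℝ^k`, as a type. It carries the subspace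
σ-algebra of the product σ-algebra on functions, i.e. the σ-algebra generated by the evaluation
maps `d ↦ d A`, for `A` a finite subset of `ℝ^k`. -/
abbrev ExtremalLinearSemidiversity (k : ℕ) : Type :=
  {d : Finset (EuclideanSpace ℝ (Fin k)) → ℝ // IsExtremalLinearSemidiversity d}

/-- `δ` is a convex combination (weighted average) of extremal linear semidiversities: it is the
(pointwise) barycentre of a probability measure on the set of extremal linear semidiversities. -/
def IsWeightedAverageOfExtremals {k : ℕ} (δ : Finset (EuclideanSpace ℝ (Fin k)) → ℝ) : Prop :=
  ∃ μ : Measure (ExtremalLinearSemidiversity k), IsProbabilityMeasure μ ∧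
    ∀ A : Finset (EuclideanSpace ℝ (Fin k)),
      Integrable (fun d : ExtremalLinearSemidiversity k => d.1 A) μ ∧
        δ A = ∫ d : ExtremalLinearSemidiversity k, d.1 A ∂μ

/-! Linear semidiversities form a closed convex cone in the product space of real functions on
finite sets. By monotonicity and Minkowski additivity, `axisSum` controls every value (`apply_le`),
so by Tychonoff its level set at `1` is a compact base of the cone, and extreme points of this base
span extremal rays. Finite subsets of a countable dense set already determine a linear semidiversity
(`ext_of_dense`). Countably many evaluations therefore separate the points of the base, and a
weighted sum of their squares is a strictly convex continuous function. Choquet's theorem then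
represents the normalized `δ` by a measure carried by extreme points, and multiplying these by
`axisSum δ` gives the required measure. Conversely, linearity passes through the integral. -/

/-! ### Choquet's theorem via a strictly convex continuous function. -/

section Choquet

/-- A positive linear functional on `C(X, ℝ)` extending the evaluation at `x` on a subspace `A`
which contains the constants, and attaining at `f` the upper envelope of `f` relative to `A`. -/
theorem exists_positive_extension_eval {X : Type*} [TopologicalSpace X] [CompactSpace X]
    (A : Submodule ℝ C(X, ℝ)) (hA : (1 : C(X, ℝ)) ∈ A) (f : C(X, ℝ)) (x : X) :
    ∃ φ : C(X, ℝ) →ₗ[ℝ] ℝ, (∀ g, 0 ≤ g → 0 ≤ φ g) ∧ (∀ h ∈ A, φ h = h x) ∧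
      ∀ ε > 0, ∃ h ∈ A, f ≤ h ∧ h x < φ f + ε := by
  classical
  by_cases hf : f ∈ A
  · refine ⟨(ContinuousMap.evalCLM ℝ x).toLinearMap, fun g hg => hg x, fun h _ => rfl,
      fun ε hε => ⟨f, hf, le_rfl, ?_⟩⟩
    change f x < f x + ε
    linarith
  set U : Set ℝ := {r | ∃ h ∈ A, f ≤ h ∧ h x = r} with hU
  have hUne : U.Nonempty := by
    refine ⟨_, ‖f‖ • (1 : C(X, ℝ)), A.smul_mem _ hA, fun y => ?_, rfl⟩
    simpa using (le_abs_self _).trans (f.norm_coe_le_norm y)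
  have hUbdd : BddBelow U := ⟨f x, by rintro r ⟨h, -, hle, rfl⟩; exact hle x⟩
  -- The upper envelope of `f` at `x`. Sending `f` to `α` keeps evaluation at `x` positive on `A + ℝ
  -- f`: the bound `hαle` serves negative coefficients of `f`, and `hfα` the others.
  set α := sInf U with hα
  have hfα : f x ≤ α := le_csInf hUne (by rintro r ⟨h, -, hle, rfl⟩; exact hle x)
  have hαle : ∀ h ∈ A, f ≤ h → α ≤ h x := fun h hh hle => csInf_le hUbdd ⟨h, hh, hle, rfl⟩
  let ev : C(X, ℝ) →ₗ.[ℝ] ℝ :=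
    ⟨A, (ContinuousMap.evalCLM ℝ x).toLinearMap.comp A.subtype⟩
  have hev : ∀ h (hh : h ∈ A), ev ⟨h, hh⟩ = h x := fun h hh => rfl
  let Φ := ev.supSpanSingleton f α hf
  have hΦ : ∀ h (hh : h ∈ A) (c : ℝ) (hm : h + c • f ∈ Φ.domain),
      Φ ⟨h + c • f, hm⟩ = h x + c * α := by
    intro h hh c hm
    exact ev.supSpanSingleton_apply_mk f α hf h hh c
  have hdom : ∀ g ∈ Φ.domain, ∃ h ∈ A, ∃ c : ℝ, h + c • f = g := by
    intro g hg
    obtain ⟨h, hh, z, hz, rfl⟩ := Submodule.mem_sup.1 hg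
    obtain ⟨c, rfl⟩ := Submodule.mem_span_singleton.1 hz
    exact ⟨h, hh, c, rfl⟩
  have hmem : ∀ h ∈ A, ∀ c : ℝ, h + c • f ∈ Φ.domain := fun h hh c =>
    Submodule.mem_sup.2 ⟨h, hh, _, Submodule.mem_span_singleton.2 ⟨c, rfl⟩, rfl⟩
  let s : PointedCone ℝ C(X, ℝ) := PointedCone.positive ℝ C(X, ℝ)
  have hs : ∀ g : C(X, ℝ), g ∈ s ↔ 0 ≤ g := fun g => Iff.rfl
  obtain ⟨φ, hφ, hpos⟩ := riesz_extension s Φ (by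
    rintro ⟨g, hg⟩ hgs
    obtain ⟨h, hh, c, rfl⟩ := hdom g hg
    rw [hΦ h hh c]
    have h0 : ∀ y, 0 ≤ h y + c * f y := fun y => (hs _).1 hgs y
    rcases lt_or_ge c 0 with hc | hc
    · have hle : f ≤ (-c)⁻¹ • h := fun y => by
        have h1 := h0 y
        change f y ≤ (-c)⁻¹ * h y
        rw [inv_mul_eq_div, le_div_iff₀ (by linarith)]
        linarith
      have h1 := hαle _ (A.smul_mem _ hh) hle
      change α ≤ (-c)⁻¹ * h x at h1
      rw [inv_mul_eq_div, le_div_iff₀ (by linarith)] at h1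
      linarith
    · have := mul_le_mul_of_nonneg_left hfα hc
      linarith [h0 x]) (by
    intro g
    refine ⟨⟨‖g‖ • (1 : C(X, ℝ)) + (0 : ℝ) • f, hmem _ (A.smul_mem _ hA) _⟩, ?_⟩
    rw [hs]
    intro y
    have := (neg_le_abs _).trans (g.norm_coe_le_norm y)
    simp
    linarith)
  have hφA : ∀ h ∈ A, φ h = h x := by
    intro h hh
    have h1 := hφ ⟨h + (0 : ℝ) • f, hmem h hh 0⟩
    rw [hΦ h hh] at h1
    simpa using h1
  have hφf : φ f = α := by
    have h1 := hφ ⟨0 + (1 : ℝ) • f, hmem 0 A.zero_mem 1⟩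
    rw [hΦ 0 A.zero_mem] at h1
    simpa using h1
  refine ⟨φ, hpos, hφA, fun ε hε => ?_⟩
  obtain ⟨r, ⟨h, hh, hle, rfl⟩, hr⟩ := exists_lt_of_csInf_lt hUne (lt_add_of_pos_right α hε)
  exact ⟨h, hh, hle, by rwa [hφf]⟩

/-- Riesz–Markov–Kakutani on a compact space, for functionals on `C(X, ℝ)`. -/
theorem exists_measure_eq_integral {X : Type*} [TopologicalSpace X] [CompactSpace X] [T2Space X]
    [MeasurableSpace X] [BorelSpace X] (φ : C(X, ℝ) →ₗ[ℝ] ℝ) (hφ : ∀ g, 0 ≤ g → 0 ≤ φ g) :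
    ∃ μ : Measure X, IsFiniteMeasure μ ∧ ∀ g : C(X, ℝ), ∫ y, g y ∂μ = φ g := by
  let ψ : CompactlySupportedContinuousMap X ℝ →ₗ[ℝ] ℝ :=
    { toFun := fun g => φ g.toContinuousMap
      map_add' := fun g h => φ.map_add _ _
      map_smul' := fun c g => φ.map_smul _ _ }
  let Λ : CompactlySupportedContinuousMap X ℝ →ₚ[ℝ] ℝ :=
    PositiveLinearMap.mk₀ ψ (fun g hg => hφ _ hg)
  refine ⟨RealRMK.rieszMeasure Λ, ⟨?_⟩, fun g => ?_⟩
  · exact isCompact_univ.measure_lt_top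
  · exact RealRMK.integral_rieszMeasure Λ (CompactlySupportedContinuousMap.continuousMapEquiv g)

/-- The affine functions among the continuous functions on a subset of a vector space. -/
def continuousAffineFunctions {V : Type*} [AddCommGroup V] [Module ℝ V] [TopologicalSpace V]
    (K : Set V) : Submodule ℝ C(K, ℝ) where
  carrier := {h | ∀ (a b c : K) (t : ℝ), (c : V) = t • (a : V) + (1 - t) • (b : V) →
    h c = t * h a + (1 - t) * h b}
  zero_mem' := by intro a b c t _; simp
  add_mem' := by
    intro g h hg hh a b c t hc
    simp only [ContinuousMap.add_apply, hg a b c t hc, hh a b c t hc]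
    ring
  smul_mem' := by
    intro r h hh a b c t hc
    simp only [ContinuousMap.smul_apply, hh a b c t hc, smul_eq_mul]
    ring

/-- **Choquet's theorem**: if the compact set `K` carries a strictly convex continuous function,
then each of its points is the barycentre of a probability measure concentrated on a measurable
set of extreme points. -/
theorem exists_measure_extremePoints {V : Type*} [AddCommGroup V] [Module ℝ V]
    [TopologicalSpace V] [T2Space V] {K : Set V} (hK : IsCompact K)
    [MeasurableSpace K] [BorelSpace K] (f : C(K, ℝ))
    (hf : ∀ (a b c : K) (t : ℝ), 0 < t → t < 1 → a ≠ b →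
      (c : V) = t • (a : V) + (1 - t) • (b : V) → f c < t * f a + (1 - t) * f b) (x : K) :
    ∃ μ : Measure K, IsProbabilityMeasure μ ∧
      (∀ h ∈ continuousAffineFunctions K, ∫ y, h y ∂μ = h x) ∧
      ∃ S : Set K, MeasurableSet S ∧ μ Sᶜ = 0 ∧ ∀ y ∈ S, (y : V) ∈ K.extremePoints ℝ := by
  have : CompactSpace K := isCompact_iff_compactSpace.1 hK
  have h1A : (1 : C(K, ℝ)) ∈ continuousAffineFunctions K := by
    intro a b c t _
    simp
  obtain ⟨φ, hpos, hφA, hφf⟩ :=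
    exists_positive_extension_eval (continuousAffineFunctions K) h1A f x
  obtain ⟨μ, hμ, hint⟩ := exists_measure_eq_integral φ hpos
  have hμ1 : μ.real Set.univ = 1 := by
    have h := (hint 1).trans (hφA 1 h1A)
    simpa using h
  have hprob : IsProbabilityMeasure μ :=
    ⟨by rwa [Measure.real, ENNReal.toReal_eq_one_iff] at hμ1⟩
  have hintegrable : ∀ g : C(K, ℝ), Integrable (fun y => g y) μ := fun g =>
    g.continuous.integrable_of_hasCompactSupport (HasCompactSupport.of_compactSpace g)
  -- Affine majorants of `f` with `∫ (u n - f) ∂μ < 1 / (n + 1)`, since `∫ u n ∂μ = u n x`.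
  choose! u huA hfu hux using fun n : ℕ => hφf (1 / ((n : ℝ) + 1)) (by positivity)
  refine ⟨μ, hprob, fun h hh => (hint h).trans (hφA h hh),
    -- The points where `f` equals the infimum of the `u n`. Markov's inequality makes the
    -- complement null.
    {y | ∀ m : ℕ, ∃ n : ℕ, u n y < f y + 1 / ((m : ℝ) + 1)}, ?_, ?_, ?_⟩
  · simp only [Set.ofPred_forall, Set.ofPred_exists]
    refine MeasurableSet.iInter fun m => MeasurableSet.iUnion fun n => ?_
    exact (isOpen_lt (u n).continuous (f.continuous.add continuous_const)).measurableSet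
  · have hcompl : {y | ∀ m : ℕ, ∃ n : ℕ, u n y < f y + 1 / ((m : ℝ) + 1)}ᶜ
        = ⋃ m : ℕ, {y | ∀ n : ℕ, f y + 1 / ((m : ℝ) + 1) ≤ u n y} := by
      ext y
      simp
    rw [hcompl, measure_iUnion_null_iff]
    intro m
    have hm : (0 : ℝ) < 1 / ((m : ℝ) + 1) := by positivity
    set T := {y | ∀ n : ℕ, f y + 1 / ((m : ℝ) + 1) ≤ u n y}
    have hbound : ∀ n : ℕ, 1 / ((m : ℝ) + 1) * μ.real T ≤ 1 / ((n : ℝ) + 1) := by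
      intro n
      have hmarkov := mul_meas_ge_le_integral_of_nonneg (μ := μ)
        (f := fun y => u n y - f y) (Filter.Eventually.of_forall fun y => sub_nonneg.2 (hfu n y))
        ((hintegrable (u n)).sub (hintegrable f)) (1 / ((m : ℝ) + 1))
      rw [integral_sub (hintegrable _) (hintegrable _), hint, hint, hφA _ (huA n)] at hmarkov
      have hsub : μ.real T ≤ μ.real {y | 1 / ((m : ℝ) + 1) ≤ u n y - f y} :=
        measureReal_mono fun y hy => by
          have := hy n
          simp only [Set.mem_ofPred_eq]
          linarith
      have := mul_le_mul_of_nonneg_left hsub hm.le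
      linarith [hux n]
    have hle : 1 / ((m : ℝ) + 1) * μ.real T ≤ 0 :=
      ge_of_tendsto' tendsto_one_div_add_atTop_nhds_zero_nat hbound
    have hT : μ.real T = 0 :=
      le_antisymm (nonpos_of_mul_nonpos_right hle hm) measureReal_nonneg
    exact (measureReal_eq_zero_iff).1 hT
  · intro y hy
    refine ⟨y.2, ?_⟩
    rintro a ha b hb ⟨s, t, hs, ht, hst, hyab⟩
    by_contra hne
    have hs1 : 1 - s = t := by linarith
    have hab : (⟨a, ha⟩ : K) ≠ ⟨b, hb⟩ := by
      intro h
      have hab : a = b := congrArg Subtype.val h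
      subst hab
      apply hne
      rw [← hyab, ← add_smul, hst, one_smul]
    have hyab' : (y : V) = s • ((⟨a, ha⟩ : K) : V) + (1 - s) • ((⟨b, hb⟩ : K) : V) := by
      rw [hs1, hyab]
    -- At an interior point of a segment, `f y` lies below the chord of `f` by a fixed gap, whereas
    -- each affine `u n` lies above that chord at `y`. This contradicts `y ∈ S`.
    have hlt := hf _ _ y s hs (by linarith) hab hyab'
    obtain ⟨m, hm⟩ := exists_nat_one_div_lt (sub_pos.2 hlt)
    obtain ⟨n, hn⟩ := hy m
    have hu := huA n _ _ y s hyab'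
    have h1 : s * f ⟨a, ha⟩ ≤ s * u n ⟨a, ha⟩ :=
      mul_le_mul_of_nonneg_left (hfu n ⟨a, ha⟩) hs.le
    have h2 : (1 - s) * f ⟨b, hb⟩ ≤ (1 - s) * u n ⟨b, hb⟩ :=
      mul_le_mul_of_nonneg_left (hfu n ⟨b, hb⟩) (by linarith)
    linarith

/-- A sequence of affine functions which separates points yields a strictly convex function. -/
theorem exists_strictConvex_of_separating {V : Type*} [AddCommGroup V] [Module ℝ V]
    [TopologicalSpace V] {K : Set V} [CompactSpace K] (u : ℕ → C(K, ℝ))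
    (hu : ∀ n, u n ∈ continuousAffineFunctions K)
    (hsep : ∀ a b : K, (∀ n, u n a = u n b) → a = b) :
    ∃ f : C(K, ℝ), ∀ (a b c : K) (t : ℝ), 0 < t → t < 1 → a ≠ b →
      (c : V) = t • (a : V) + (1 - t) • (b : V) → f c < t * f a + (1 - t) * f b := by
  -- The second factor bounds each term by `(1 / 2) ^ n`; adding `1` avoids dividing by zero.
  let w : ℕ → ℝ := fun n => (1 / 2) ^ n * (1 / (1 + ‖u n‖ ^ 2))
  have hw : ∀ n, 0 < w n := fun n => by positivity
  have hbound : ∀ n (y : K), ‖w n * (u n y) ^ 2‖ ≤ (1 / 2 : ℝ) ^ n := by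
    intro n y
    have h1 : (u n y) ^ 2 ≤ 1 + ‖u n‖ ^ 2 := by
      have := (u n).norm_coe_le_norm y
      have h2 : ‖u n y‖ ^ 2 ≤ ‖u n‖ ^ 2 := by gcongr
      rw [Real.norm_eq_abs, sq_abs] at h2
      linarith
    rw [Real.norm_of_nonneg (by have := hw n; positivity)]
    change (1 / 2) ^ n * (1 / (1 + ‖u n‖ ^ 2)) * (u n y) ^ 2 ≤ _
    rw [mul_assoc]
    refine mul_le_of_le_one_right (by positivity) ?_
    rw [one_div_mul_eq_div, div_le_one (by positivity)]
    exact h1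
  have hgeom : Summable fun n : ℕ => (1 / 2 : ℝ) ^ n := summable_geometric_two
  have hsum : ∀ y : K, Summable fun n => w n * (u n y) ^ 2 := fun y =>
    Summable.of_norm_bounded hgeom fun n => hbound n y
  refine ⟨⟨fun y => ∑' n, w n * (u n y) ^ 2,
    continuous_tsum (fun n => by fun_prop) hgeom hbound⟩, ?_⟩
  intro a b c t ht0 ht1 hab hc
  have ht2 : 0 < 1 - t := by linarith
  have key : ∀ n, t * (w n * (u n a) ^ 2) + (1 - t) * (w n * (u n b) ^ 2) - w n * (u n c) ^ 2
      = w n * (t * (1 - t)) * (u n a - u n b) ^ 2 := by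
    intro n
    rw [hu n a b c t hc]
    ring
  obtain ⟨i, hi⟩ : ∃ i, u i a ≠ u i b := by
    by_contra! h
    exact hab (hsep a b h)
  simp only [ContinuousMap.coe_mk]
  rw [← tsum_mul_left, ← tsum_mul_left,
    ← Summable.tsum_add ((hsum a).mul_left t) ((hsum b).mul_left (1 - t))]
  refine Summable.tsum_lt_tsum (i := i) (fun n => ?_) ?_ (hsum c)
    (((hsum a).mul_left t).add ((hsum b).mul_left (1 - t)))
  · have h1 := key n
    have h2 : 0 ≤ w n * (t * (1 - t)) * (u n a - u n b) ^ 2 := by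
      have := hw n; positivity
    linarith
  · have h1 := key i
    have h2 : 0 < w i * (t * (1 - t)) * (u i a - u i b) ^ 2 := by
      have := hw i
      have := sub_ne_zero.2 hi
      positivity
    linarith

end Choquet

/-! ### Bounds and continuity of linear semidiversities. -/

section LinearSemidiversity

open scoped Classical

theorem IsSemidiversity.mono {X : Type*} {δ : Finset X → ℝ} (h : IsSemidiversity δ)
    {A B : Finset X} (hAB : A ⊆ B) : δ A ≤ δ B := by
  have hins : ∀ (b : X) (A : Finset X), δ A ≤ δ (insert b A) := by
    intro b A
    have h1 := h.triangle A {b} ∅ (Finset.singleton_nonempty b)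
    have h2 := h.eq_zero_of_card_le_one {b} (by simp)
    simp only [Finset.union_empty, h2, add_zero] at h1
    rwa [Finset.union_comm, ← Finset.insert_eq] at h1
  have hun : ∀ C : Finset X, δ A ≤ δ (C ∪ A) := by
    intro C
    induction C using Finset.induction_on with
    | empty => simp
    | insert b C _ ih =>
      rw [Finset.insert_union]
      exact ih.trans (hins b _)
  have := hun B
  rwa [Finset.union_eq_left.2 hAB] at this

variable {k : ℕ} {δ : Finset (EuclideanSpace ℝ (Fin k)) → ℝ}

/-- The sum of the values of `δ` on the coordinate segments. -/
noncomputable def axisSum (δ : Finset (EuclideanSpace ℝ (Fin k)) → ℝ) : ℝ :=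
  ∑ i, δ {0, EuclideanSpace.single i (1 : ℝ)}

namespace IsLinearSemidiversity

theorem translate (h : IsLinearSemidiversity δ) (A : Finset (EuclideanSpace ℝ (Fin k)))
    (hA : A.Nonempty) (x : EuclideanSpace ℝ (Fin k)) : δ (A + {x}) = δ A := by
  rw [h.linear.map_add A {x} hA (Finset.singleton_nonempty x),
    h.semidiversity.eq_zero_of_card_le_one {x} (by simp), add_zero]

theorem le_of_subset_add (h : IsLinearSemidiversity δ)
    {A B C : Finset (EuclideanSpace ℝ (Fin k))} (hB : B.Nonempty) (hC : C.Nonempty)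
    (hA : A ⊆ B + C) : δ A ≤ δ B + δ C :=
  (h.semidiversity.mono hA).trans_eq (h.linear.map_add B C hB hC)

theorem pair_smul_of_nonneg (h : IsLinearSemidiversity δ) (x : EuclideanSpace ℝ (Fin k)) {t : ℝ}
    (ht : 0 ≤ t) : δ {0, t • x} = t * δ {0, x} := by
  rw [← h.linear.map_smul t {0, x} ht (by simp)]
  congr 1
  ext y
  simp [Finset.mem_smul_finset, eq_comm]

theorem pair_smul (h : IsLinearSemidiversity δ) (x : EuclideanSpace ℝ (Fin k)) (t : ℝ) :
    δ {0, t • x} = |t| * δ {0, x} := by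
  rcases le_total 0 t with ht | ht
  · rw [abs_of_nonneg ht, h.pair_smul_of_nonneg x ht]
  · rw [abs_of_nonpos ht, ← h.pair_smul_of_nonneg x (neg_nonneg.2 ht),
      ← h.translate {0, -t • x} (by simp) (t • x)]
    congr 1
    ext y
    simp [Finset.mem_add, eq_comm, or_comm]

theorem pair_add_le (h : IsLinearSemidiversity δ) (x y : EuclideanSpace ℝ (Fin k)) :
    δ {0, x + y} ≤ δ {0, x} + δ {0, y} := by
  refine h.le_of_subset_add (by simp) (by simp) ?_
  intro z hz
  simp only [Finset.mem_insert, Finset.mem_singleton] at hz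
  rcases hz with rfl | rfl
  · exact Finset.mem_add.2 ⟨0, by simp, 0, by simp, by simp⟩
  · exact Finset.mem_add.2 ⟨x, by simp, y, by simp, rfl⟩

theorem axisSum_nonneg (h : IsLinearSemidiversity δ) : 0 ≤ axisSum δ :=
  Finset.sum_nonneg fun _ _ => h.semidiversity.nonneg _

theorem pair_le (h : IsLinearSemidiversity δ) (x : EuclideanSpace ℝ (Fin k)) :
    δ {0, x} ≤ ‖x‖ * axisSum δ := by
  have h0 : δ {0, (0 : EuclideanSpace ℝ (Fin k))} = 0 :=
    h.semidiversity.eq_zero_of_card_le_one _ (by simp)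
  have hx : x = ∑ i, x i • EuclideanSpace.single i (1 : ℝ) := by
    ext j
    simp [Finset.sum_apply, Pi.single_apply]
  have h1 := Finset.le_sum_of_subadditive (fun y => δ {0, y}) h0.le h.pair_add_le Finset.univ
    (fun i => x i • EuclideanSpace.single i (1 : ℝ))
  rw [← hx] at h1
  refine h1.trans ?_
  rw [axisSum, Finset.mul_sum]
  refine Finset.sum_le_sum fun i _ => ?_
  rw [h.pair_smul]
  exact mul_le_mul_of_nonneg_right (PiLp.norm_apply_le x i) (h.semidiversity.nonneg _)

/-- After adjoining `0`, a set lies in the Minkowski sum of the segments `{0, a}`, so additivity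
reduces the bound to `pair_le`. This is the source of compactness. -/
theorem apply_le (h : IsLinearSemidiversity δ) (A : Finset (EuclideanSpace ℝ (Fin k))) :
    δ A ≤ (∑ a ∈ A, ‖a‖) * axisSum δ := by
  refine (h.semidiversity.mono (Finset.subset_insert 0 A)).trans ?_
  induction A using Finset.induction_on with
  | empty => simpa using (h.semidiversity.eq_zero_of_card_le_one {0} (by simp)).le
  | insert a A ha ih =>
    rw [Finset.sum_insert ha, add_mul]
    refine (h.le_of_subset_add (B := {0, a}) (C := insert 0 A) (by simp) (by simp) ?_).trans
      (add_le_add (h.pair_le a) ih)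
    intro z hz
    simp only [Finset.mem_insert] at hz
    rcases hz with rfl | rfl | hz
    · exact Finset.mem_add.2 ⟨0, by simp, 0, by simp, by simp⟩
    · exact Finset.mem_add.2 ⟨z, by simp, 0, by simp, by simp⟩
    · exact Finset.mem_add.2 ⟨0, by simp, z, by simp [hz], by simp⟩

theorem axisSum_pos (h : IsLinearSemidiversity δ) (h0 : δ ≠ 0) : 0 < axisSum δ := by
  refine h.axisSum_nonneg.lt_of_ne' fun hs => h0 (funext fun A => ?_)
  have := h.apply_le A
  rw [hs, mul_zero] at this
  exact le_antisymm this (h.semidiversity.nonneg A)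

/-- Moving each point of a finite set by at most `ε` changes the value by a bounded multiple
of `ε`. -/
theorem apply_le_image_add (h : IsLinearSemidiversity δ)
    (A : Finset (EuclideanSpace ℝ (Fin k)))
    (r s : EuclideanSpace ℝ (Fin k) → EuclideanSpace ℝ (Fin k)) (ε : ℝ)
    (hrs : ∀ a ∈ A, ‖r a - s a‖ ≤ ε) :
    δ (A.image r) ≤ δ (A.image s) + A.card * ε * axisSum δ := by
  rcases A.eq_empty_or_nonempty with rfl | hA
  · simp
  -- Writing `r a = s a + (r a - s a)` puts the first image inside the second plus a set of small
  -- vectors.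
  refine (h.le_of_subset_add (hA.image s) (hA.image fun a => r a - s a) ?_).trans
    (add_le_add le_rfl ((h.apply_le _).trans
      (mul_le_mul_of_nonneg_right ?_ h.axisSum_nonneg)))
  · intro z hz
    obtain ⟨a, ha, rfl⟩ := Finset.mem_image.1 hz
    exact Finset.mem_add.2 ⟨s a, Finset.mem_image_of_mem s ha, r a - s a,
      Finset.mem_image_of_mem (fun a => r a - s a) ha, by simp⟩
  · obtain ⟨a₀, ha₀⟩ := hA
    have hε : 0 ≤ ε := (norm_nonneg _).trans (hrs a₀ ha₀)
    calc ∑ b ∈ A.image (fun a => r a - s a), ‖b‖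
        ≤ ∑ b ∈ A.image (fun a => r a - s a), ε := Finset.sum_le_sum fun b hb => by
          obtain ⟨a, ha, rfl⟩ := Finset.mem_image.1 hb
          exact hrs a ha
      _ = (A.image (fun a => r a - s a)).card * ε := by simp
      _ ≤ A.card * ε := by 
          exact mul_le_mul_of_nonneg_right (Nat.cast_le.2 Finset.card_image_le) hε

/-- A linear semidiversity is determined by its values on the finite subsets of a dense set. -/
theorem ext_of_dense {δ' : Finset (EuclideanSpace ℝ (Fin k)) → ℝ}
    (h : IsLinearSemidiversity δ) (h' : IsLinearSemidiversity δ')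
    {D : Set (EuclideanSpace ℝ (Fin k))} (hD : Dense D)
    (heq : ∀ B : Finset (EuclideanSpace ℝ (Fin k)), (B : Set _) ⊆ D → δ B = δ' B) : δ = δ' := by
  have key : ∀ {δ δ' : Finset (EuclideanSpace ℝ (Fin k)) → ℝ} (_ : IsLinearSemidiversity δ)
      (_ : IsLinearSemidiversity δ')
      (_ : ∀ B : Finset (EuclideanSpace ℝ (Fin k)), (B : Set _) ⊆ D → δ B = δ' B)
      (A : Finset (EuclideanSpace ℝ (Fin k))), δ A ≤ δ' A := by
    intro δ δ' h h' heq A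
    have hε : ∀ n : ℕ, δ A - δ' A ≤ (A.card * (axisSum δ + axisSum δ')) * (1 / ((n : ℝ) + 1)) := by
      intro n
      choose s hsD hs using fun x => hD.exists_dist_lt x
        (Nat.one_div_pos_of_nat : 0 < 1 / ((n : ℝ) + 1))
      have h1 := h.apply_le_image_add A id s (1 / ((n : ℝ) + 1)) fun a _ => by
        simpa [dist_eq_norm] using (hs a).le
      have h2 := h'.apply_le_image_add A s id (1 / ((n : ℝ) + 1)) fun a _ => by
        simpa [dist_eq_norm, norm_sub_rev] using (hs a).le
      rw [Finset.image_id] at h1 h2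
      rw [heq (A.image s) (by simpa [Set.subset_def] using fun a _ => hsD a)] at h1
      linarith
    have ht := (tendsto_one_div_add_atTop_nhds_zero_nat (𝕜 := ℝ)).const_mul
      (A.card * (axisSum δ + axisSum δ'))
    rw [mul_zero] at ht
    exact sub_nonpos.1 (ge_of_tendsto' ht hε)
  exact funext fun A => le_antisymm (key h h' heq A)
    (key h' h (fun B hB => (heq B hB).symm) A)

theorem smul (h : IsLinearSemidiversity δ) {c : ℝ} (hc : 0 ≤ c) :
    IsLinearSemidiversity (c • δ) where
  semidiversity :=
    { nonneg := fun A => mul_nonneg hc (h.semidiversity.nonneg A)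
      eq_zero_of_card_le_one := fun A hA => by
        simp [h.semidiversity.eq_zero_of_card_le_one A hA]
      triangle := fun A B C hB => by
        have h1 := mul_le_mul_of_nonneg_left (h.semidiversity.triangle A B C hB) hc
        simp only [Pi.smul_apply, smul_eq_mul]
        linarith }
  linear :=
    { map_smul := fun r A hr hA => by
        simp only [Pi.smul_apply, smul_eq_mul, h.linear.map_smul r A hr hA]
        ring
      map_add := fun A B hA hB => by
        simp only [Pi.smul_apply, smul_eq_mul, h.linear.map_add A B hA hB]
        ring }

end IsLinearSemidiversity

theorem axisSum_add (δ δ' : Finset (EuclideanSpace ℝ (Fin k)) → ℝ) :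
    axisSum (δ + δ') = axisSum δ + axisSum δ' := by
  simp [axisSum, Finset.sum_add_distrib]

theorem axisSum_smul (c : ℝ) (δ : Finset (EuclideanSpace ℝ (Fin k)) → ℝ) :
    axisSum (c • δ) = c * axisSum δ := by
  simp [axisSum, Finset.mul_sum]

end LinearSemidiversity

/-! ### The compact base and the integral representation. -/

section NormalizedBase

open scoped Classical

/-- The linear semidiversities on `ℝ^k` normalized on the coordinate segments: a compact base of
the cone of linear semidiversities. -/
def normalizedLinearSemidiversities (k : ℕ) : Set (Finset (EuclideanSpace ℝ (Fin k)) → ℝ) :=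
  {d | IsLinearSemidiversity d ∧ axisSum d = 1}

theorem continuous_axisSum (k : ℕ) :
    Continuous (axisSum : (Finset (EuclideanSpace ℝ (Fin k)) → ℝ) → ℝ) :=
  continuous_finsetSum _ fun _ _ => continuous_apply _

theorem isClosed_forall {X : Type*} {ι : Sort*} [TopologicalSpace X] {p : ι → X → Prop}
    (h : ∀ i, IsClosed {x | p i x}) : IsClosed {x | ∀ i, p i x} := by
  simp only [Set.ofPred_forall]
  exact isClosed_iInter h

theorem isClosed_isLinearSemidiversity (k : ℕ) :
    IsClosed {d : Finset (EuclideanSpace ℝ (Fin k)) → ℝ | IsLinearSemidiversity d} := by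
  have heq : {d : Finset (EuclideanSpace ℝ (Fin k)) → ℝ | IsLinearSemidiversity d} =
      {d | (∀ A, 0 ≤ d A) ∧ (∀ A, A.card ≤ 1 → d A = 0) ∧
        (∀ A B C, B.Nonempty → d (A ∪ C) ≤ d (A ∪ B) + d (B ∪ C)) ∧
        (∀ (c : ℝ) A, 0 ≤ c → A.Nonempty → d (c • A) = c * d A) ∧
        (∀ A B, A.Nonempty → B.Nonempty → d (A + B) = d A + d B)} := by
    ext d
    exact ⟨fun h => ⟨h.1.1, h.1.2, fun A B C hB => by convert h.1.3 A B C hB, h.2.1, h.2.2⟩,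
      fun h => ⟨⟨h.1, h.2.1, fun A B C hB => by convert h.2.2.1 A B C hB⟩,
        ⟨h.2.2.2.1, h.2.2.2.2⟩⟩⟩
  rw [heq]
  refine IsClosed.and ?_ (IsClosed.and ?_ (IsClosed.and ?_ (IsClosed.and ?_ ?_)))
  · exact isClosed_forall fun A => isClosed_le continuous_const (continuous_apply A)
  · exact isClosed_forall fun A => isClosed_forall fun _ =>
      isClosed_eq (continuous_apply A) continuous_const
  · exact isClosed_forall fun A => isClosed_forall fun B => isClosed_forall fun C =>
      isClosed_forall fun _ => isClosed_le (by fun_prop)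
        (by fun_prop)
  · exact isClosed_forall fun c => isClosed_forall fun A => isClosed_forall fun _ =>
      isClosed_forall fun _ => isClosed_eq (by fun_prop)
        (continuous_const.mul (continuous_apply _))
  · exact isClosed_forall fun A => isClosed_forall fun B => isClosed_forall fun _ =>
      isClosed_forall fun _ => isClosed_eq (by fun_prop)
        (by fun_prop)

theorem isCompact_normalizedLinearSemidiversities (k : ℕ) :
    IsCompact (normalizedLinearSemidiversities k) := by
  refine (isCompact_univ_pi fun A : Finset (EuclideanSpace ℝ (Fin k)) =>
    isCompact_Icc (a := (0 : ℝ)) (b := ∑ a ∈ A, ‖a‖)).of_isClosed_subset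
    ((isClosed_isLinearSemidiversity k).and
      (isClosed_eq (continuous_axisSum k) continuous_const)) ?_
  rintro d ⟨hd, h1⟩ A -
  have := hd.apply_le A
  rw [h1, mul_one] at this
  exact ⟨hd.semidiversity.nonneg A, this⟩

theorem apply_mem_continuousAffineFunctions {ι : Type*} (K : Set (ι → ℝ)) (i : ι) :
    (⟨fun d => d.1 i,
      (continuous_apply _).comp continuous_subtype_val⟩ : C(K, ℝ)) ∈ continuousAffineFunctions K := by
  intro a b c t hc
  simp [hc]

theorem exists_strictConvex_normalizedLinearSemidiversities (k : ℕ) :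
    ∃ f : C(normalizedLinearSemidiversities k, ℝ),
      ∀ (a b c : normalizedLinearSemidiversities k) (t : ℝ), 0 < t → t < 1 → a ≠ b →
      c.1 = t • a.1 + (1 - t) • b.1 → f c < t * f a + (1 - t) * f b := by
  obtain ⟨D, hDc, hD⟩ := TopologicalSpace.exists_countable_dense (EuclideanSpace ℝ (Fin k))
  have := hDc.to_subtype
  have : CompactSpace (normalizedLinearSemidiversities k) :=
    isCompact_iff_compactSpace.1 (isCompact_normalizedLinearSemidiversities k)
  obtain ⟨F, hF⟩ := exists_surjective_nat (Finset D)
  refine exists_strictConvex_of_separating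
    (fun n => ⟨fun d => d.1 ((F n).map (Function.Embedding.subtype _)),
      (continuous_apply _).comp continuous_subtype_val⟩)
    (fun n => apply_mem_continuousAffineFunctions _ _) fun a b hab => ?_
  -- `D` is countable, so its finite subsets are enumerated by `F`.
  refine Subtype.ext (a.2.1.ext_of_dense b.2.1 hD fun B hB => ?_)
  obtain ⟨n, hn⟩ := hF (B.subtype (· ∈ D))
  have h := hab n
  simp only [ContinuousMap.coe_mk, hn] at h
  rwa [Finset.subtype_map_of_mem fun x hx => hB hx] at h

/-- The positive multiples of an extreme point of the base are extremal. -/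
theorem IsExtremalLinearSemidiversity.of_mem_extremePoints {k : ℕ}
    {d : Finset (EuclideanSpace ℝ (Fin k)) → ℝ}
    (hd : d ∈ (normalizedLinearSemidiversities k).extremePoints ℝ) {c : ℝ} (hc : 0 < c) :
    IsExtremalLinearSemidiversity (c • d) := by
  have hd1 : axisSum d = 1 := hd.1.2
  have hnorm : ∀ {δ : Finset (EuclideanSpace ℝ (Fin k)) → ℝ}, IsLinearSemidiversity δ →
      0 < axisSum δ → (axisSum δ)⁻¹ • δ ∈ normalizedLinearSemidiversities k := fun h hpos =>
    ⟨h.smul (inv_nonneg.2 hpos.le), by rw [axisSum_smul, inv_mul_cancel₀ hpos.ne']⟩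
  -- Normalizing two non-zero summands writes `d` as a convex combination in the base, with weights
  -- their axis sums.
  have key : ∀ δ₁ δ₂ : Finset (EuclideanSpace ℝ (Fin k)) → ℝ, IsLinearSemidiversity δ₁ →
      IsLinearSemidiversity δ₂ → d = δ₁ + δ₂ → δ₁ = axisSum δ₁ • d := by
    intro δ₁ δ₂ h₁ h₂ hsum
    rcases eq_or_ne δ₁ 0 with rfl | hne₁
    · simp [axisSum]
    have hs₁ := h₁.axisSum_pos hne₁
    rcases eq_or_ne δ₂ 0 with rfl | hne₂
    · rw [add_zero] at hsum
      rw [← hsum, hd1, one_smul]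
    have hs₂ := h₂.axisSum_pos hne₂
    have hadd : axisSum δ₁ + axisSum δ₂ = 1 := by rw [← axisSum_add, ← hsum, hd1]
    have hext := hd.2 (hnorm h₁ hs₁) (hnorm h₂ hs₂)
      ⟨axisSum δ₁, axisSum δ₂, hs₁, hs₂, hadd, by
        rw [smul_inv_smul₀ hs₁.ne', smul_inv_smul₀ hs₂.ne', hsum]⟩
    rw [← hext, smul_inv_smul₀ hs₁.ne']
  have scale : ∀ (δ₁ δ₂ : Finset (EuclideanSpace ℝ (Fin k)) → ℝ) (t : ℝ),
      IsLinearSemidiversity δ₁ → IsLinearSemidiversity δ₂ → 0 < t → t < 1 →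
      c • d = t • δ₁ + (1 - t) • δ₂ → IsScaleCopy δ₁ (c • d) := by
    intro δ₁ δ₂ t h₁ h₂ ht0 ht1 hsum
    have ht : 0 < c⁻¹ * t := by positivity
    have h := key ((c⁻¹ * t) • δ₁) ((c⁻¹ * (1 - t)) • δ₂) (h₁.smul ht.le)
      (h₂.smul (mul_nonneg (inv_nonneg.2 hc.le) (by linarith)))
      (by rw [mul_smul, mul_smul, ← smul_add, ← hsum, inv_smul_smul₀ hc.ne'])
    rw [axisSum_smul, mul_smul (c⁻¹ * t) (axisSum δ₁) d] at h
    have h' := smul_right_injective _ ht.ne' h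
    refine ⟨axisSum δ₁ * c⁻¹, mul_nonneg h₁.axisSum_nonneg (inv_nonneg.2 hc.le), ?_⟩
    rw [h', axisSum_smul, hd1, mul_one, mul_smul, inv_smul_smul₀ hc.ne']
  refine ⟨hd.1.1.smul hc.le, fun h => ?_, fun δ₁ δ₂ t h₁ h₂ ht0 ht1 hsum =>
    ⟨scale δ₁ δ₂ t h₁ h₂ ht0 ht1 hsum, scale δ₂ δ₁ (1 - t) h₂ h₁ (by linarith) (by linarith) ?_⟩⟩
  · have h0 := congrArg axisSum h
    rw [axisSum_smul, hd1, mul_one] at h0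
    exact hc.ne' (h0.trans (by simp [axisSum]))
  · rw [hsum, sub_sub_cancel, add_comm]

theorem IsLinearSemidiversity.isWeightedAverageOfExtremals {k : ℕ}
    {δ : Finset (EuclideanSpace ℝ (Fin k)) → ℝ} (h : IsLinearSemidiversity δ) (h0 : δ ≠ 0) :
    IsWeightedAverageOfExtremals δ := by
  have hs := h.axisSum_pos h0
  let K := normalizedLinearSemidiversities k
  let x : K := ⟨(axisSum δ)⁻¹ • δ, h.smul (inv_nonneg.2 hs.le), by
    rw [axisSum_smul, inv_mul_cancel₀ hs.ne']⟩
  obtain ⟨f, hf⟩ := exists_strictConvex_normalizedLinearSemidiversities k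
  have hK : IsCompact K := isCompact_normalizedLinearSemidiversities k
  have : CompactSpace K := isCompact_iff_compactSpace.1 hK
  let _ : MeasurableSpace K := borel K
  have : BorelSpace K := ⟨rfl⟩
  obtain ⟨μ, hμ, hbary, S, hS, hSc, hSext⟩ := exists_measure_extremePoints hK f hf x
  obtain ⟨y₀, hy₀⟩ : S.Nonempty := by
    by_contra hne
    rw [Set.not_nonempty_iff_eq_empty] at hne
    simp [hne] at hSc
  have heval : ∀ A, Continuous fun y : K => y.1 A := fun A =>
    (continuous_apply A).comp continuous_subtype_val
  -- Redefining points off `S` on a null set gives a map that takes extreme values everywhere, so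
  -- measurability of the set of all extreme points is not needed.
  let r : K → K := fun y => if y ∈ S then y else y₀
  have hr : Measurable r := Measurable.ite hS measurable_id measurable_const
  have hrS : ∀ y, r y ∈ S := by
    intro y
    by_cases hy : y ∈ S <;> simp [r, hy, hy₀]
  have hrae : ∀ᵐ y ∂μ, r y = y := by
    filter_upwards [(mem_ae_iff.2 hSc : S ∈ ae μ)] with y hy
    simp [r, hy]
  -- The factor `axisSum δ` undoes the normalization of `x`.
  let T : K → ExtremalLinearSemidiversity k := fun y =>
    ⟨axisSum δ • (r y).1, .of_mem_extremePoints (hSext _ (hrS y)) hs⟩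
  have hT : Measurable T := by
    refine Measurable.subtype_mk (measurable_pi_iff.2 fun A => ?_)
    exact ((heval A).measurable.comp hr).const_mul (axisSum δ)
  have hTae : ∀ A, (fun y => (T y).1 A) =ᵐ[μ] fun y => axisSum δ * y.1 A := fun A => by
    filter_upwards [hrae] with y hy
    simp [T, hy]
  have hmeas : ∀ A, Measurable fun d : ExtremalLinearSemidiversity k => d.1 A := fun A =>
    (measurable_pi_apply A).comp measurable_subtype_coe
  refine ⟨μ.map T, Measure.isProbabilityMeasure_map hT.aemeasurable, fun A => ⟨?_, ?_⟩⟩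
  · rw [integrable_map_measure (hmeas A).aestronglyMeasurable hT.aemeasurable]
    refine Integrable.congr ?_ (hTae A).symm
    exact (((heval A).integrable_of_hasCompactSupport
      (HasCompactSupport.of_compactSpace _)).const_mul _)
  · rw [integral_map hT.aemeasurable (hmeas A).aestronglyMeasurable, integral_congr_ae (hTae A),
      integral_const_mul]
    have hx := hbary _ (apply_mem_continuousAffineFunctions K A)
    simp only [ContinuousMap.coe_mk] at hx
    rw [hx]
    simp [x, hs.ne']

theorem IsWeightedAverageOfExtremals.isMinkowskiLinear {k : ℕ}
    {δ : Finset (EuclideanSpace ℝ (Fin k)) → ℝ} (h : IsWeightedAverageOfExtremals δ) :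
    IsMinkowskiLinear δ := by
  obtain ⟨μ, -, hμ⟩ := h
  refine ⟨fun c A hc hA => ?_, fun A B hA hB => ?_⟩
  · rw [(hμ _).2, (hμ A).2, ← integral_const_mul]
    exact integral_congr_ae (.of_forall fun d => d.2.1.linear.map_smul c A hc hA)
  · rw [(hμ _).2, (hμ A).2, (hμ B).2, ← integral_add (hμ A).1 (hμ B).1]
    exact integral_congr_ae (.of_forall fun d => d.2.1.linear.map_add A B hA hB)

end NormalizedBase

theorem mainTheorem3 (k : ℕ) (δ : Finset (EuclideanSpace ℝ (Fin k)) → ℝ)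
    (hδ : IsSemidiversity δ) (hδ0 : δ ≠ 0) :
    IsMinkowskiLinear δ ↔ IsWeightedAverageOfExtremals δ :=
  ⟨fun h => IsLinearSemidiversity.isWeightedAverageOfExtremals ⟨hδ, h⟩ hδ0,
    fun h => h.isMinkowskiLinear⟩
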